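/- All graphs are finite and simple, and $\Delta(G)$ denotes the maximum degree of $G$. Definitions. A $k$-list-assignment of $G$ is a map $L:V(G)\to 2^{\mathbb N}$ with $|L(v)|=k$ for every $v$. An $L$-colouring is a proper colouring $c:V(G)\to\mathbb N$ with $c(v)\in L(v)$ for every $v$. An $L$-packing of size $k$ is a collection of $k$ pairwise disjoint $L$-colourings, that is, $L$-colourings any two of which differ at every vertex. The list packing number $\chi_\ell^\star(G)$ is the least integer $k\ge 1$ such that $G$ admits an $L$-packing of size $k$ for every $k$-list-assignment $L$ of $G$. A correspondence-cover of $G$ is a pair $(L,H)$ of a graph $H$ and a map $L:V(G)\to 2^{V(H)}$ such that (i) the sets $L(v)$, $v\in V(G)$, partition $V(H)$; (ii) for distinct non-adjacent $u,v\in V(G)$ there is no edge of $H$ between $L(u)$ and $L(v)$; (iii) for every $uv\in E(G)$ the edges of $H$ between $L(u)$ and $L(v)$ form a (possibly empty) matching; (iv) each $L(v)$ is a clique of $H$. It is $k$-fold if $|L(v)|=k$ for every $v$. A packing of size $k$ of the cover is a partition of $V(H)$ into $k$ independent sets of $H$, each of size $|V(G)|$. The correspondence packing number $\chi_c^\star(G)$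 is the least integer $k\ge 1$ such that every $k$-fold correspondence-cover of $G$ admits a packing of size $k$. Theorem. Let $G$ be a graph. 1. If $\Delta(G)\in\{2,3\}$, then $\chi_\ell^\star(G)\le \Delta(G)+1$. 2. If $\Delta(G)\in\{2,3,4\}$, then $\chi_c^\star(G)\le 2\left\lceil\frac{\Delta(G)+1}{2}\right\rceil$. 3. If $\Delta(G)\le 3$, then $\chi_\ell^\star(G)\le\chi_c^\star(G)\le 4$. -/

import Mathlib

universe u

/-! ### List packing -/

/-- `L` is a `k`-list-assignment: every vertex receives a list of exactly `k` colours. -/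
def IsListAssignment {V : Type u} (L : V → Finset ℕ) (k : ℕ) : Prop :=
  ∀ v, (L v).card = k

/-- `c` is a (proper) `L`-colouring of `G`. -/
structure IsListColoring {V : Type u} (G : SimpleGraph V) (L : V → Finset ℕ) (c : V → ℕ) :
    Prop where
  mem_list : ∀ v, c v ∈ L v
  proper : ∀ v w, G.Adj v w → c v ≠ c w

/-- `G` admits an `L`-packing of size `k`: a collection of `k` pairwise disjoint `L`-colourings,
where two colourings are disjoint if they differ at every vertex. -/
def HasListPacking {V : Type u} (G : SimpleGraph V) (L : V → Finset ℕ) (k : ℕ) : Prop :=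
  ∃ c : Fin k → V → ℕ,
    (∀ i, IsListColoring G L (c i)) ∧ ∀ i j, i ≠ j → ∀ v, c i v ≠ c j v

/-- The list packing number of `G`: the least positive `k` such that `G` admits an `L`-packing of
size `k` for every `k`-list-assignment `L` of `G` (it would be `⊤` if there were no such `k`).
Lists of size `0` are excluded, since the condition is vacuous for them. -/
noncomputable def listPackingNumber {V : Type u} (G : SimpleGraph V) : ℕ∞ :=
  sInf {n : ℕ∞ | ∃ k : ℕ, n = (k : ℕ∞) ∧ 0 < k ∧
    ∀ L : V → Finset ℕ, IsListAssignment L k → HasListPacking G L k}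

/-! ### Correspondence packing -/

/-- The pair `(L, H)` is a correspondence-cover of `G`. -/
structure IsCorrespondenceCover {V W : Type u} (G : SimpleGraph V) (H : SimpleGraph W)
    (L : V → Finset W) : Prop where
  /-- `L` induces a partition of the vertex set of `H`. -/
  partition : ∀ x : W, ∃! v : V, x ∈ L v
  /-- There are no edges of `H` between the lists of distinct non-adjacent vertices. -/
  empty_of_not_adj : ∀ u v : V, u ≠ v → ¬ G.Adj u v →
    ∀ x ∈ L u, ∀ y ∈ L v, ¬ H.Adj x y
  /-- The edges of `H` between the lists of adjacent vertices form a (possibly empty, not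
  necessarily perfect) matching. As `u` and `v` may be swapped, it suffices that every vertex in
  the first list has at most one neighbour in the second list. -/
  matching_of_adj : ∀ u v : V, G.Adj u v →
    ∀ x ∈ L u, ∀ y ∈ L v, ∀ z ∈ L v, H.Adj x y → H.Adj x z → y = z
  /-- Every list is a clique of `H`. -/
  clique : ∀ v : V, H.IsClique (L v : Set W)

/-- `I` is a colouring of `G` with respect to a cover with cover graph `H`: an independent set
of `H` of size `|V(G)|`. -/
def IsCoverColoring {V W : Type u} [Fintype V] (_G : SimpleGraph V) (H : SimpleGraph W)
    (I : Finset W) : Prop :=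
  H.IsIndepSet (I : Set W) ∧ I.card = Fintype.card V

/-- The cover of `G` with cover graph `H` admits a packing of size `k`: a partition of the vertex
set of `H` into `k` colourings. -/
def HasCoverPacking {V W : Type u} [Fintype V] (G : SimpleGraph V) (H : SimpleGraph W)
    (k : ℕ) : Prop :=
  ∃ I : Fin k → Finset W, (∀ i, IsCoverColoring G H (I i)) ∧ ∀ x : W, ∃! i, x ∈ I i

/-- The correspondence packing number of `G`: the least positive `k` such that every `k`-fold
correspondence-cover `(L, H)` of `G` admits a packing of size `k` (it would be `⊤` if there were no
such `k`). Since `k`-fold covers of a finite graph are finite, every one of them is isomorphic to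
one whose vertices lie in the universe of `V`. -/
noncomputable def correspondencePackingNumber {V : Type u} [Fintype V] (G : SimpleGraph V) : ℕ∞ :=
  sInf {n : ℕ∞ | ∃ k : ℕ, n = (k : ℕ∞) ∧ 0 < k ∧
    ∀ (W : Type u) (H : SimpleGraph W) (L : V → Finset W),
      IsCorrespondenceCover G H L → (∀ v, (L v).card = k) → HasCoverPacking G H k}

/-! ### Hall's theorem and permutations avoiding given permutations. -/

open Equiv (Perm)

/-! A packing is an ordering of every list, that is, a permutation of `Fin k` at each vertex, with
no conflict in any position across an edge. Once the matchings are completed to permutations `σ u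
v`, a new vertex `v` only has to receive a permutation disjoint from `σ u v * π u` for each treated
neighbour `u`. By Hall's theorem `d` permutations of `Fin k` can be avoided as soon as `2 * d ≤ k`
(`exists_perm_avoiding`).

Components are treated separately. With maximum degree `d + 1` and `(d, k)` equal to `(3, 6)`, `(2,
4)` or `(1, 3)`, a connected graph can be processed greedily towards a root, since every other
vertex still has an untreated neighbour nearer the root. Only the end of the process, where all
neighbours are treated, needs an argument.

Degree 4, `k = 6`: both ends of an edge are left to the end and chosen together
(`exists_disjoint_pair_avoiding`). If a first choice for one end blocks the other, Hall's theorem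
yields a saturated 3 by 4 block, and changing the choice in two of its rows removes every
obstruction.

Degree 3, `k = 4`: if every degree is 3, the last vertex `v` has neighbours `z` and `w`, where `w`
is treated while having only one treated neighbour. This freedom lets the permutation at `w` be
chosen so that, together with the one at `z`, it never blocks `v`, whatever the third neighbour gets
(`exists_perm_avoiding_extendable`).

Degree 2, lists of size 3: if all lists agree, a proper 3-colouring gives cyclic shifts of one
ordering. Otherwise some edge has a colour on one side only, and the conflict saved there allows the
greedy process to close.

The remaining list bounds follow because a list-assignment is a special correspondence-cover. -/

theorem exists_perm_of_no_block {n : ℕ} (R : Fin n → Fin n → Prop)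
    (h : ∀ S T : Finset (Fin n), (∀ s ∈ S, ∀ t ∈ T, ¬ R s t) → S.card + T.card ≤ n) :
    ∃ p : Perm (Fin n), ∀ i, R i (p i) := by
  classical
  obtain ⟨f, hf, hR⟩ := (Finset.all_card_le_biUnion_card_iff_exists_injective
    (fun i : Fin n => Finset.univ.filter (R i))).1 (by
      intro S
      -- The complement of the neighbourhood of `S` forms a forbidden block with `S`, so the block
      -- bound is Hall's condition.
      have := h S (S.biUnion fun i => Finset.univ.filter (R i))ᶜ (by
        intro s hs t ht hst
        simp only [Finset.mem_compl, Finset.mem_biUnion, Finset.mem_filter, Finset.mem_univ,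
          true_and, not_exists, not_and] at ht
        exact ht s hs hst)
      rw [Finset.card_compl, Fintype.card_fin] at this
      have h2 := Finset.card_le_univ (S.biUnion fun i => Finset.univ.filter (R i))
      rw [Fintype.card_fin] at h2
      omega)
  refine ⟨Equiv.ofBijective f (Finite.injective_iff_bijective.1 hf), fun i => ?_⟩
  simpa using hR i

theorem card_le_of_forall_exists_apply_eq {n d : ℕ} {β : Type*} (h : Fin d → β → Fin n) (s : β)
    {T : Finset (Fin n)} (hT : ∀ t ∈ T, ∃ j, h j s = t) : T.card ≤ d := by
  classical
  have : T ⊆ Finset.univ.image (fun j => h j s) := fun t ht => by simpa using hT t ht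
  simpa using (Finset.card_le_card this).trans Finset.card_image_le

/-- Up to `n / 2` permutations of `Fin n` can be avoided by a further one. -/
theorem exists_perm_avoiding {n d : ℕ} (hd : 2 * d ≤ n) (f : Fin d → Perm (Fin n)) :
    ∃ p : Perm (Fin n), ∀ j i, p i ≠ f j i := by
  obtain ⟨p, hp⟩ := exists_perm_of_no_block (fun i c : Fin n => ∀ j, c ≠ f j i) (by
    intro S T hST
    push Not at hST
    rcases S.eq_empty_or_nonempty with rfl | ⟨s, hs⟩
    · simpa using Finset.card_le_univ T
    rcases T.eq_empty_or_nonempty with rfl | ⟨t, ht⟩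
    · simpa using Finset.card_le_univ S
    -- Each permutation covers at most one cell in a row or column, so a forbidden block has both
    -- sides at most `d`.
    have h1 : T.card ≤ d := card_le_of_forall_exists_apply_eq (fun j i => f j i) s
      fun t ht => (hST s hs t ht).imp fun j hj => hj.symm
    have h2 : S.card ≤ d := card_le_of_forall_exists_apply_eq (fun j i => (f j)⁻¹ i) t
      fun s hs => (hST s hs t ht).imp fun j hj => by simp [hj]
    omega)
  exact ⟨p, fun j i => hp i j⟩

/-! ### Disjoint pairs of permutations of six symbols. -/

/-- Three permutations of `Fin 6`, together with two cells of another permutation, can be avoided. -/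
theorem exists_perm_avoiding_two_cells (f : Fin 3 → Perm (Fin 6)) (m : Perm (Fin 6))
    (a b : Fin 6) :
    ∃ p : Perm (Fin 6), (∀ j i, p i ≠ f j i) ∧ p a ≠ m a ∧ p b ≠ m b := by
  classical
  obtain ⟨p, hp⟩ := exists_perm_of_no_block
    (fun i c : Fin 6 => (∀ j, c ≠ f j i) ∧ ((i = a ∨ i = b) → c ≠ m i)) (by
    intro S T hST
    have hST' : ∀ s ∈ S, ∀ t ∈ T, (∃ j, f j s = t) ∨ ((s = a ∨ s = b) ∧ m s = t) := by
      intro s hs t ht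
      have := hST s hs t ht
      by_contra hcon
      push Not at hcon
      exact this ⟨fun j hj => hcon.1 j hj.symm, fun h hj => hcon.2 h hj.symm⟩
    by_contra hcard
    have hS6 := Finset.card_le_univ S
    have hT6 := Finset.card_le_univ T
    rw [Fintype.card_fin] at hS6 hT6
    -- A row with more than three forbidden cells must be one of the two special rows, and then has
    -- at most four; a block with four columns thus has total size at most 6. The permutations are
    -- general so that the same bound serves the transposed block.
    have key : ∀ (h : Fin 3 → Perm (Fin 6)) (q : Perm (Fin 6)) (x y : Fin 6)
        (A B : Finset (Fin 6)), 6 < A.card + B.card → A.card ≤ 6 →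
        (∀ s ∈ A, ∀ t ∈ B, (∃ j, h j s = t) ∨ ((s = x ∨ s = y) ∧ q s = t)) → B.card ≤ 3 := by
      intro h q x y A B hAB hA hc
      by_contra hB
      have hsub : A ⊆ {x, y} := by
        intro s hs
        by_contra hxy
        simp only [Finset.mem_insert, Finset.mem_singleton] at hxy
        exact hB (card_le_of_forall_exists_apply_eq (fun j i => h j i) s
          fun t ht => (hc s hs t ht).resolve_right fun h => hxy h.1)
      have hA2 : A.card ≤ 2 := (Finset.card_le_card hsub).trans Finset.card_le_two
      obtain ⟨s, hs⟩ : A.Nonempty := by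
        rw [← Finset.card_pos]; have := Finset.card_le_univ B; rw [Fintype.card_fin] at this; omega
      have : B.card ≤ 4 := card_le_of_forall_exists_apply_eq
        (fun (j : Fin 4) i => (Fin.cons q h : Fin 4 → Perm (Fin 6)) j i) s
        fun t ht => by
          rcases hc s hs t ht with ⟨j, hj⟩ | ⟨-, hj⟩
          · exact ⟨j.succ, by simpa using hj⟩
          · exact ⟨0, by simpa using hj⟩
      omega
    have h1 := key f m a b S T (by omega) hS6 hST'
    have h2 := key (fun j => (f j)⁻¹) m⁻¹ (m a) (m b) T S (by omega) hT6 (by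
      intro t ht s hs
      rcases hST' s hs t ht with ⟨j, hj⟩ | ⟨hs, hj⟩
      · exact Or.inl ⟨j, by simp [← hj]⟩
      · refine Or.inr ⟨?_, by simp [← hj]⟩
        rcases hs with rfl | rfl
        · exact Or.inl hj.symm
        · exact Or.inr hj.symm)
    omega)
  exact ⟨p, fun j i => (hp i).1 j, (hp a).2 (Or.inl rfl), (hp b).2 (Or.inr rfl)⟩

/-- The cells of `S × T`, with three rows and four columns, are all covered by the permutations `g`
and `p`. -/
structure IsBlock (g : Fin 3 → Perm (Fin 6)) (p : Perm (Fin 6)) (S T : Finset (Fin 6)) : Prop where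
  card_rows : S.card = 3
  card_cols : T.card = 4
  cover : ∀ s ∈ S, ∀ t ∈ T, (∃ j, g j s = t) ∨ p s = t

namespace IsBlock

variable {g : Fin 3 → Perm (Fin 6)} {p : Perm (Fin 6)} {S T : Finset (Fin 6)}

/-- Four values have to fill four columns, so a row of a block is saturated: no value is repeated
and none leaves `T`. -/
theorem image_eq (h : IsBlock g p S T) {s : Fin 6} (hs : s ∈ S) :
    Finset.univ.image (fun o : Option (Fin 3) => o.elim (p s) (g · s)) = T ∧
      Function.Injective (fun o : Option (Fin 3) => o.elim (p s) (g · s)) := by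
  classical
  have hsub : T ⊆ Finset.univ.image (fun o : Option (Fin 3) => o.elim (p s) (g · s)) := by
    intro t ht
    simp only [Finset.mem_image, Finset.mem_univ, true_and]
    rcases h.cover s hs t ht with ⟨j, hj⟩ | hj
    · exact ⟨some j, hj⟩
    · exact ⟨none, hj⟩
  have hle : (Finset.univ.image (fun o : Option (Fin 3) => o.elim (p s) (g · s))).card ≤ 4 := by
    simpa using Finset.card_image_le (s := (Finset.univ : Finset (Option (Fin 3))))
      (f := fun o : Option (Fin 3) => o.elim (p s) (g · s))
  have heq := Finset.eq_of_subset_of_card_le hsub (by rw [h.card_cols]; exact hle)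
  refine ⟨heq.symm, ?_⟩
  have : Set.InjOn (fun o : Option (Fin 3) => o.elim (p s) (g · s))
      ((Finset.univ : Finset (Option (Fin 3))) : Set (Option (Fin 3))) := by
    rw [← Finset.card_image_iff, ← heq, h.card_cols]; simp
  simpa using this

theorem apply_mem (h : IsBlock g p S T) {s : Fin 6} (hs : s ∈ S) (j : Fin 3) : g j s ∈ T := by
  rw [← (h.image_eq hs).1]
  exact Finset.mem_image_of_mem (fun o : Option (Fin 3) => o.elim (p s) (g · s))
    (Finset.mem_univ (some j))

theorem last_mem (h : IsBlock g p S T) {s : Fin 6} (hs : s ∈ S) : p s ∈ T := by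
  rw [← (h.image_eq hs).1]
  exact Finset.mem_image_of_mem (fun o : Option (Fin 3) => o.elim (p s) (g · s))
    (Finset.mem_univ none)

theorem apply_inj (h : IsBlock g p S T) {s : Fin 6} (hs : s ∈ S) {i j : Fin 3}
    (hij : g i s = g j s) : i = j :=
  Option.some_injective _ ((h.image_eq hs).2 hij)

theorem apply_ne_last (h : IsBlock g p S T) {s : Fin 6} (hs : s ∈ S) (j : Fin 3) :
    g j s ≠ p s := fun hj => by
  simpa using (h.image_eq hs).2 (show (some j : Option (Fin 3)).elim (p s) (g · s) =
    (none : Option (Fin 3)).elim (p s) (g · s) from hj)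

/-- Moving away from `m` in two rows of a block destroys it and creates no other block of the same
shape. Two blocks share at most one row, so their row union is nearly everything; since each `g j`
maps it into the column union, counting leaves no room. -/
theorem not_isBlock {m : Perm (Fin 6)} (h : IsBlock g m S T) {a b : Fin 6} (ha : a ∈ S)
    (hb : b ∈ S) (hab : a ≠ b) (hpa : p a ≠ m a) (hpb : p b ≠ m b) (S' T' : Finset (Fin 6)) :
    ¬ IsBlock g p S' T' := by
  classical
  intro h'
  have hagree : ∀ s ∈ S, s ∈ S' → p s = m s → T = T' := fun s hs hs' he => by
    rw [← (h.image_eq hs).1, ← (h'.image_eq hs').1, he]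
  have hUI : ∀ A B : Finset (Fin 6), (A ∪ B).card + (A ∩ B).card = A.card + B.card :=
    Finset.card_union_add_card_inter
  have hS := hUI S S'
  have hT := hUI T T'
  rw [h.card_rows, h'.card_rows] at hS
  rw [h.card_cols, h'.card_cols] at hT
  have hmap : ∀ j, (S ∪ S').image (g j) ⊆ T ∪ T' := by
    intro j t ht
    simp only [Finset.mem_image, Finset.mem_union] at ht ⊢
    obtain ⟨s, hs | hs, rfl⟩ := ht
    · exact Or.inl (h.apply_mem hs j)
    · exact Or.inr (h'.apply_mem hs j)
  have hcardmap : ∀ j, ((S ∪ S').image (g j)).card = (S ∪ S').card := fun j =>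
    Finset.card_image_of_injective _ (g j).injective
  have hle : (S ∪ S').card ≤ (T ∪ T').card := hcardmap 0 ▸ Finset.card_le_card (hmap 0)
  -- In a common row the three values of `g` lie in both column sets, so distinct column sets differ
  -- only in the values of `m` and `p`.
  have hmiss : ∀ s ∈ S, s ∈ S' → T ≠ T' → m s ∉ T' ∧ (T ∩ T').card = 3 := by
    intro s hs hs' hne
    have hps : p s ≠ m s := fun he => hne (hagree s hs hs' he)
    have hms : m s ∉ T' := by
      intro hm
      rcases h'.cover s hs' _ hm with ⟨j, hj⟩ | hj
      · exact h.apply_ne_last hs j hj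
      · exact hps hj
    refine ⟨hms, le_antisymm ?_ ?_⟩
    · have : T ∩ T' ⊆ T.erase (m s) := by
        intro t ht
        rw [Finset.mem_inter] at ht
        exact Finset.mem_erase.2 ⟨fun he => hms (he ▸ ht.2), ht.1⟩
      have := Finset.card_le_card this
      rw [Finset.card_erase_of_mem (h.last_mem hs), h.card_cols] at this
      omega
    · have : Finset.univ.image (fun j => g j s) ⊆ T ∩ T' := by
        intro t ht
        simp only [Finset.mem_image, Finset.mem_univ, true_and] at ht
        obtain ⟨j, rfl⟩ := ht
        exact Finset.mem_inter.2 ⟨h.apply_mem hs j, h'.apply_mem hs' j⟩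
      have := Finset.card_le_card this
      rwa [Finset.card_image_of_injective _ (fun i j hij => h.apply_inj hs hij),
        Finset.card_univ, Fintype.card_fin] at this
  by_cases hTT : T = T'
  · have ha' : a ∉ S' := fun ha' => by
      rcases h'.cover a ha' _ (hTT ▸ h.last_mem ha) with ⟨j, hj⟩ | hj
      · exact h.apply_ne_last ha j hj
      · exact hpa hj
    have hb' : b ∉ S' := fun hb' => by
      rcases h'.cover b hb' _ (hTT ▸ h.last_mem hb) with ⟨j, hj⟩ | hj
      · exact h.apply_ne_last hb j hj
      · exact hpb hj
    have hsub : S ∩ S' ⊆ (S.erase a).erase b := by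
      intro s hs
      rw [Finset.mem_inter] at hs
      exact Finset.mem_erase.2 ⟨fun he => hb' (he ▸ hs.2),
        Finset.mem_erase.2 ⟨fun he => ha' (he ▸ hs.2), hs.1⟩⟩
    have := Finset.card_le_card hsub
    rw [Finset.card_erase_of_mem (Finset.mem_erase.2 ⟨hab.symm, hb⟩),
      Finset.card_erase_of_mem ha, h.card_rows] at this
    have hU : (T ∪ T').card = 4 := by rw [← hTT, Finset.union_self, h.card_cols]
    omega
  · have hone : (S ∩ S').card ≤ 1 := by
      rw [Finset.card_le_one]
      intro s hs t ht
      rw [Finset.mem_inter] at hs ht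
      by_contra hst
      have h1 := hmiss s hs.1 hs.2 hTT
      have h2 := hmiss t ht.1 ht.2 hTT
      have : T ∩ T' ⊆ (T.erase (m s)).erase (m t) := by
        intro x hx
        rw [Finset.mem_inter] at hx
        exact Finset.mem_erase.2 ⟨fun he => h2.1 (he ▸ hx.2),
          Finset.mem_erase.2 ⟨fun he => h1.1 (he ▸ hx.2), hx.1⟩⟩
      have := Finset.card_le_card this
      rw [Finset.card_erase_of_mem (Finset.mem_erase.2
        ⟨fun he => hst (m.injective he).symm, h.last_mem ht.1⟩),
        Finset.card_erase_of_mem (h.last_mem hs.1), h.card_cols, h1.2] at this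
      omega
    have hcase : (S ∩ S').card = 0 ∨ ((S ∩ S').card = 1 ∧ (T ∩ T').card = 3) := by
      rcases Nat.eq_zero_or_pos (S ∩ S').card with h0 | h0
      · exact Or.inl h0
      · obtain ⟨s, hs⟩ := Finset.card_pos.1 h0
        rw [Finset.mem_inter] at hs
        exact Or.inr ⟨by omega, (hmiss s hs.1 hs.2 hTT).2⟩
    have hTu := Finset.card_le_univ (T ∪ T')
    rw [Fintype.card_fin] at hTu
    -- The row and column unions both have 6 elements, or both 5, according to whether there are
    -- zero or one common rows.
    have himg : ∀ j, (S ∪ S').image (g j) = T ∪ T' := fun j =>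
      Finset.eq_of_subset_of_card_le (hmap j) (by rw [hcardmap]; omega)
    have hm : ∀ s ∈ S, m s ∈ T' := by
      intro s hs
      by_contra hms
      -- If `m s` is outside `T'`, its three preimages under `g` exhaust `S`, so one of them is `s`,
      -- against the saturation of row `s`.
      have hpre : ∀ j, (g j)⁻¹ (m s) ∈ S := by
        intro j
        have : m s ∈ (S ∪ S').image (g j) := by
          rw [himg]; exact Finset.mem_union_left _ (h.last_mem hs)
        obtain ⟨r, hr, hrm⟩ := Finset.mem_image.1 this
        rw [← hrm, Equiv.Perm.coe_inv, Equiv.symm_apply_apply]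
        rcases Finset.mem_union.1 hr with hr | hr
        · exact hr
        · exact absurd (hrm ▸ h'.apply_mem hr j) hms
      have hinj : Function.Injective fun j => (g j)⁻¹ (m s) := by
        intro i j hij
        refine h.apply_inj (hpre i) ?_
        have hij' : (g i)⁻¹ (m s) = (g j)⁻¹ (m s) := hij
        have hc : ∀ k, g k ((g k)⁻¹ (m s)) = m s := fun k => by simp
        rw [hc, hij', hc]
      have hsurj : Finset.univ.image (fun j => (g j)⁻¹ (m s)) = S := by
        refine Finset.eq_of_subset_of_card_le (fun r hr => ?_) ?_
        · obtain ⟨j, -, rfl⟩ := Finset.mem_image.1 hr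
          exact hpre j
        · rw [Finset.card_image_of_injective _ hinj, h.card_rows]; simp
      rw [← hsurj] at hs
      obtain ⟨j, -, hj⟩ := Finset.mem_image.1 hs
      refine h.apply_ne_last (s := s) (by rw [← hsurj]; exact hs) j ?_
      rw [← hj, Equiv.Perm.coe_inv, Equiv.apply_symm_apply]
      exact congrArg m hj.symm
    have hsub : S.image m ⊆ T ∩ T' := by
      intro t ht
      obtain ⟨s, hs, rfl⟩ := Finset.mem_image.1 ht
      exact Finset.mem_inter.2 ⟨h.last_mem hs, hm s hs⟩
    have := Finset.card_le_card hsub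
    rw [Finset.card_image_of_injective _ m.injective, h.card_rows] at this
    rcases Nat.eq_zero_or_pos (S ∩ S').card with h0 | h0
    · omega
    · obtain ⟨s, hs⟩ := Finset.card_pos.1 h0
      rw [Finset.mem_inter] at hs
      exact (hmiss s hs.1 hs.2 hTT).1 (hm s hs.1)

/-- The companion for the transposed shape, four rows by three columns. Saturation in both
directions forces `S ⊆ S'` and then `T' ⊆ T`; as `m a` and `m b` are no longer covered in rows `a`
and `b`, at most two columns remain for `T'`. -/
theorem not_isBlock_inv {m : Perm (Fin 6)} (h : IsBlock g m S T) {a b : Fin 6} (ha : a ∈ S)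
    (hb : b ∈ S) (hab : a ≠ b) (hpa : p a ≠ m a) (hpb : p b ≠ m b) (S' T' : Finset (Fin 6)) :
    ¬ IsBlock (fun j => (g j)⁻¹) p⁻¹ T' S' := by
  classical
  intro h'
  have hcov : ∀ s ∈ S', ∀ t ∈ T', (∃ j, g j s = t) ∨ p s = t := by
    intro s hs t ht
    rcases h'.cover t ht s hs with ⟨j, hj⟩ | hj
    · exact Or.inl ⟨j, by simp [← hj]⟩
    · exact Or.inr (by simp [← hj])
  have hrow : ∀ t ∈ T', ∀ j s, g j s = t → s ∈ S' := by
    rintro t ht j s rfl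
    simpa using h'.apply_mem ht j
  have hout : ∀ t ∈ T', t ∉ T → ∀ s ∈ S, s ∈ S' → p s = t := by
    intro t ht htT s hs hs'
    rcases hcov s hs' t ht with ⟨j, rfl⟩ | hj
    · exact absurd (h.apply_mem hs j) htT
    · exact hj
  have hSS : S ⊆ S' := by
    intro s hs
    by_contra hs'
    have h3 : Finset.univ.image (fun j => g j s) ⊆ T \ T' := by
      intro t ht
      obtain ⟨j, -, rfl⟩ := Finset.mem_image.1 ht
      exact Finset.mem_sdiff.2 ⟨h.apply_mem hs j, fun ht' => hs' (hrow _ ht' j s rfl)⟩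
    have h3 := Finset.card_le_card h3
    rw [Finset.card_image_of_injective _ (fun i j hij => h.apply_inj hs hij),
      Finset.card_univ, Fintype.card_fin] at h3
    have e1 := Finset.card_sdiff_add_card_inter T T'
    have e2 := Finset.card_sdiff_add_card_inter T' T
    rw [Finset.inter_comm T' T] at e2
    rw [h.card_cols] at e1
    rw [h'.card_rows] at e2
    obtain ⟨x, hx, y, hy, hxy⟩ := Finset.one_lt_card.1 (show 1 < (T' \ T).card by omega)
    rw [Finset.mem_sdiff] at hx hy
    -- A common row would force `p` to take both values `x` and `y` there.
    have hdisj : Disjoint S S' := by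
      rw [Finset.disjoint_left]
      intro r hr hr'
      exact hxy ((hout x hx.1 hx.2 r hr hr').symm.trans (hout y hy.1 hy.2 r hr hr'))
    have := Finset.card_le_univ (S ∪ S')
    rw [Finset.card_union_of_disjoint hdisj, h.card_rows, h'.card_cols, Fintype.card_fin] at this
    omega
  have hsub : T' ⊆ (T.erase (m a)).erase (m b) := by
    intro t ht
    have htT : t ∈ T := by
      by_contra htT
      exact hab (p.injective ((hout t ht htT a ha (hSS ha)).trans
        (hout t ht htT b hb (hSS hb)).symm))
    refine Finset.mem_erase.2 ⟨?_, Finset.mem_erase.2 ⟨?_, htT⟩⟩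
    · rintro rfl
      rcases hcov b (hSS hb) _ ht with ⟨j, hj⟩ | hj
      · exact h.apply_ne_last hb j hj
      · exact hpb hj
    · rintro rfl
      rcases hcov a (hSS ha) _ ht with ⟨j, hj⟩ | hj
      · exact h.apply_ne_last ha j hj
      · exact hpa hj
  have := Finset.card_le_card hsub
  rw [Finset.card_erase_of_mem (Finset.mem_erase.2
      ⟨fun he => hab (m.injective he).symm, h.last_mem hb⟩),
    Finset.card_erase_of_mem (h.last_mem ha), h.card_cols, h'.card_rows] at this
  omega

end IsBlock

/-- A Hall obstruction to avoiding four permutations has both sides at most 4 and total at least 7,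
hence contains a 3 by 4 block or is a 4 by 3 block. -/
theorem exists_perm_avoiding_or_isBlock (g : Fin 3 → Perm (Fin 6)) (p : Perm (Fin 6)) :
    (∃ q : Perm (Fin 6), (∀ j i, q i ≠ g j i) ∧ ∀ i, q i ≠ p i) ∨
      (∃ S T, IsBlock g p S T) ∨ ∃ S T, IsBlock (fun j => (g j)⁻¹) p⁻¹ T S := by
  classical
  by_contra hcon
  push Not at hcon
  obtain ⟨hq, hR, hC⟩ := hcon
  obtain ⟨q, hq'⟩ := exists_perm_of_no_block
    (fun i c : Fin 6 => (∀ j, c ≠ g j i) ∧ c ≠ p i) (by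
      intro S T hST
      have hST' : ∀ s ∈ S, ∀ t ∈ T, (∃ j, g j s = t) ∨ p s = t := by
        intro s hs t ht
        have := hST s hs t ht
        by_contra hcon
        push Not at hcon
        exact this ⟨fun j hj => hcon.1 j hj.symm, fun hj => hcon.2 hj.symm⟩
      by_contra hcard
      have hS6 := Finset.card_le_univ S
      have hT6 := Finset.card_le_univ T
      rw [Fintype.card_fin] at hS6 hT6
      obtain ⟨s, hs⟩ : S.Nonempty := Finset.card_pos.1 (by omega)
      obtain ⟨t, ht⟩ : T.Nonempty := Finset.card_pos.1 (by omega)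
      have hT4 : T.card ≤ 4 := card_le_of_forall_exists_apply_eq
        (fun (j : Fin 4) i => (Fin.cons p g : Fin 4 → Perm (Fin 6)) j i) s
        fun t ht => by
          rcases hST' s hs t ht with ⟨j, hj⟩ | hj
          · exact ⟨j.succ, by simpa using hj⟩
          · exact ⟨0, by simpa using hj⟩
      have hS4 : S.card ≤ 4 := card_le_of_forall_exists_apply_eq
        (fun (j : Fin 4) i => ((Fin.cons p g : Fin 4 → Perm (Fin 6)) j)⁻¹ i) t
        fun s hs => by
          rcases hST' s hs t ht with ⟨j, hj⟩ | hj
          · exact ⟨j.succ, by simp [← hj]⟩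
          · exact ⟨0, by simp [← hj]⟩
      rcases (show T.card = 4 ∨ (S.card = 4 ∧ T.card = 3) by omega) with hT | ⟨hS, hT⟩
      · obtain ⟨S₀, hS₀, hc⟩ := Finset.exists_subset_card_eq (show 3 ≤ S.card by omega)
        exact hR S₀ T ⟨hc, hT, fun s hs t ht => hST' s (hS₀ hs) t ht⟩
      · refine hC S T ⟨hT, hS, fun t ht s hs => ?_⟩
        rcases hST' s hs t ht with ⟨j, hj⟩ | hj
        · exact Or.inl ⟨j, by simp [← hj]⟩
        · exact Or.inr (by simp [← hj]))
  obtain ⟨i, hi⟩ := hq q fun j i => (hq' i).1 j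
  exact (hq' i).2 hi

theorem IsBlock.exists_pair {g : Fin 3 → Perm (Fin 6)} {m : Perm (Fin 6)} {S T : Finset (Fin 6)}
    (h : IsBlock g m S T) (f : Fin 3 → Perm (Fin 6)) :
    ∃ p q : Perm (Fin 6), (∀ j i, p i ≠ f j i) ∧ (∀ j i, q i ≠ g j i) ∧ ∀ i, q i ≠ p i := by
  obtain ⟨a, ha, b, hb, hab⟩ := Finset.one_lt_card.1 (show 1 < S.card by rw [h.card_rows]; omega)
  obtain ⟨p, hp, hpa, hpb⟩ := exists_perm_avoiding_two_cells f m a b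
  rcases exists_perm_avoiding_or_isBlock g p with ⟨q, hq⟩ | ⟨S', T', h'⟩ | ⟨S', T', h'⟩
  · exact ⟨p, q, hp, hq⟩
  · exact absurd h' (h.not_isBlock ha hb hab hpa hpb S' T')
  · exact absurd h' (h.not_isBlock_inv ha hb hab hpa hpb S' T')

/-- Given two triples of permutations of `Fin 6`, there are disjoint permutations avoiding the
first and the second triple, respectively. -/
theorem exists_disjoint_pair_avoiding (f g : Fin 3 → Perm (Fin 6)) :
    ∃ p q : Perm (Fin 6), (∀ j i, p i ≠ f j i) ∧ (∀ j i, q i ≠ g j i) ∧ ∀ i, q i ≠ p i := by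
  obtain ⟨m, hm⟩ := exists_perm_avoiding (by norm_num) f
  rcases exists_perm_avoiding_or_isBlock g m with ⟨q, hq⟩ | ⟨S, T, h⟩ | ⟨S, T, h⟩
  · exact ⟨m, q, hm, hq⟩
  · exact h.exists_pair f
  -- Inverting all permutations transposes the block and preserves disjointness.
  · obtain ⟨p, q, hp, hq, hpq⟩ := h.exists_pair fun j => (f j)⁻¹
    have inv : ∀ a b : Perm (Fin 6), (∀ i, a i ≠ b⁻¹ i) → ∀ i, a⁻¹ i ≠ b i := fun a b hab i hi =>
      hab (a⁻¹ i) (by rw [show a (a⁻¹ i) = i by simp, hi]; simp)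
    exact ⟨p⁻¹, q⁻¹, fun j => inv _ _ (hp j), fun j => inv _ _ (hq j),
      inv q p⁻¹ (by simpa using hpq)⟩

/-! ### Finite checks on permutations of three and four symbols. -/

theorem exists_involution_avoiding :
    ∀ f : Perm (Fin 4), ∃ p : Perm (Fin 4), (∀ i, p i ≠ f i) ∧ p * p = 1 := by
  decide +kernel

/-- Three permutations of four symbols can be unavoidable in general; this never happens when two of
them are the identity and an involution. -/
theorem exists_perm_avoiding_involution :
    ∀ p : Perm (Fin 4), p * p = 1 → ∀ g : Perm (Fin 4),
      ∃ q : Perm (Fin 4), ∀ i, q i ≠ i ∧ q i ≠ p i ∧ q i ≠ g i := by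
  decide +kernel

/-- Given permutations `a` and `f` of `Fin 4`, there is a permutation avoiding `f` which together
with `a` does not obstruct the avoidance of any third permutation. -/
theorem exists_perm_avoiding_extendable (a f : Perm (Fin 4)) :
    ∃ p : Perm (Fin 4), (∀ i, p i ≠ f i) ∧
      ∀ g : Perm (Fin 4), ∃ q : Perm (Fin 4), ∀ i, q i ≠ a i ∧ q i ≠ p i ∧ q i ≠ g i := by
  obtain ⟨p, hp, hpp⟩ := exists_involution_avoiding (a⁻¹ * f)
  refine ⟨a * p, fun i hi => hp i ?_, fun g => ?_⟩
  · simp [← hi]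
  · obtain ⟨q, hq⟩ := exists_perm_avoiding_involution p hpp (a⁻¹ * g)
    refine ⟨a * q, fun i => ⟨fun h => (hq i).1 ?_, fun h => (hq i).2.1 ?_, fun h => (hq i).2.2 ?_⟩⟩
    · simpa using h
    · simpa using h
    · simp [← h]

/-- Used to choose both ends of the last edge in the list case; the cell at `x` is the one freed by
a colour that is missing from a neighbouring list. -/
theorem exists_pair_avoiding_of_missing_cell :
    ∀ (f g : Perm (Fin 3)) (x : Fin 3), ∃ p q : Perm (Fin 3),
      (∀ i, p i ≠ f i) ∧ (∀ i, q i ≠ p i) ∧ ∀ i, i ≠ x → q i ≠ g i := by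
  decide +kernel

/-! ### Greedy choice of states along an ordering. -/

/-- The states `π` are pairwise compatible along all edges of `G` inside `X`. -/
def IsCompatibleOn {V P : Type*} (G : SimpleGraph V) (c : V → V → P → P → Prop) (X : Finset V)
    (π : V → P) : Prop :=
  ∀ u ∈ X, ∀ v ∈ X, G.Adj u v → c u v (π u) (π v)

/-- Any choice of states on at most `d` neighbours of a vertex extends to that vertex. -/
def IsExtendable {V P : Type*} (G : SimpleGraph V) (c : V → V → P → P → Prop) (d : ℕ) : Prop :=
  ∀ (v : V) (N : Finset V) (π : V → P), (∀ u ∈ N, G.Adj u v) → N.card ≤ d →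
    ∃ p, ∀ u ∈ N, c u v (π u) p

/-- Every vertex has at most `d` neighbours. -/
def DegreeLE {V : Type*} (G : SimpleGraph V) (d : ℕ) : Prop :=
  ∀ (v : V) (N : Finset V), (∀ u ∈ N, G.Adj u v) → N.card ≤ d

section Greedy

variable {V P : Type*} [DecidableEq V] {G : SimpleGraph V} {c : V → V → P → P → Prop}

theorem IsCompatibleOn.insert (hc : ∀ u v p q, c u v p q → c v u q p) {X : Finset V} {π : V → P}
    (h : IsCompatibleOn G c X π) {v : V} (hv : v ∉ X) {p : P}
    (hp : ∀ u ∈ X, G.Adj u v → c u v (π u) p) :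
    IsCompatibleOn G c (insert v X) (Function.update π v p) := by
  have hne : ∀ x ∈ X, x ≠ v := fun x hx he => hv (he ▸ hx)
  intro x hx' y hy' hxy
  rcases Finset.mem_insert.1 hx' with rfl | hx <;>
    rcases Finset.mem_insert.1 hy' with rfl | hy
  · exact absurd hxy (G.irrefl)
  · rw [Function.update_self, Function.update_of_ne (hne y hy)]
    exact hc _ _ _ _ (hp y hy hxy.symm)
  · rw [Function.update_self, Function.update_of_ne (hne x hx)]
    exact hp x hx hxy
  · rw [Function.update_of_ne (hne x hx), Function.update_of_ne (hne y hy)]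
    exact h x hx y hy hxy

/-- Greedy extension of states in order of decreasing rank `r`. -/
theorem IsCompatibleOn.exists_extension (hc : ∀ u v p q, c u v p q → c v u q p) {d : ℕ}
    (hext : IsExtendable G c d) (r : V → ℕ) {X₀ : Finset V} {π : V → P}
    (h : IsCompatibleOn G c X₀ π) (X : Finset V) (hdisj : Disjoint X₀ X)
    (hr : ∀ v ∈ X, ∀ N ⊆ X₀ ∪ X, (∀ u ∈ N, G.Adj u v) → (∀ u ∈ N, u ∈ X → r v ≤ r u) →
      N.card ≤ d) :
    ∃ π' : V → P, (∀ u ∈ X₀, π' u = π u) ∧ IsCompatibleOn G c (X₀ ∪ X) π' := by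
  classical
  -- The inserted vertex has the least rank, so it is treated after all the others, ties included.
  induction X using Finset.induction_on_min_value r with
  | empty => exact ⟨π, fun _ _ => rfl, by simpa using h⟩
  | insert a s ha hmin ih =>
    rw [Finset.disjoint_insert_right] at hdisj
    obtain ⟨π₁, hπ₁, h₁⟩ := ih hdisj.2 fun v hv N hN hadj hrank =>
      hr v (Finset.mem_insert_of_mem hv) N
        (hN.trans (Finset.union_subset_union_right (Finset.subset_insert a s))) hadj
        fun u hu hus => hrank u hu (by
          rcases Finset.mem_union.1 (hN hu) with hu' | hu'
          · rcases Finset.mem_insert.1 hus with rfl | hus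
            · exact absurd hu' hdisj.1
            · exact hus
          · exact hu')
    obtain ⟨p, hp⟩ := hext a ((X₀ ∪ s).filter fun u => G.Adj u a) π₁
      (fun u hu => (Finset.mem_filter.1 hu).2)
      (hr a (Finset.mem_insert_self a s) _
        ((Finset.filter_subset _ _).trans
          (Finset.union_subset_union_right (Finset.subset_insert a s)))
        (fun u hu => (Finset.mem_filter.1 hu).2)
        fun u _ hus => by
          rcases Finset.mem_insert.1 hus with rfl | hus
          · exact le_rfl
          · exact hmin u hus)
    have hnot : a ∉ X₀ ∪ s := by simp [ha, hdisj.1]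
    refine ⟨Function.update π₁ a p, fun u hu => ?_, ?_⟩
    · rw [Function.update_of_ne (fun he : u = a => hdisj.1 (he ▸ hu)), hπ₁ u hu]
    · rw [Finset.union_insert]
      exact h₁.insert hc hnot fun u hu hua => hp u (Finset.mem_filter.2 ⟨hu, hua⟩)

theorem exists_isCompatibleOn [Nonempty P] (hc : ∀ u v p q, c u v p q → c v u q p) {d : ℕ}
    (hext : IsExtendable G c d) (r : V → ℕ) (X : Finset V)
    (hr : ∀ v ∈ X, ∀ N ⊆ X, (∀ u ∈ N, G.Adj u v) → (∀ u ∈ N, r v ≤ r u) → N.card ≤ d) :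
    ∃ π : V → P, IsCompatibleOn G c X π := by
  obtain ⟨π, -, hπ⟩ := IsCompatibleOn.exists_extension (X₀ := ∅)
    (π := fun _ => Classical.arbitrary P) hc hext r (fun u hu => by simp at hu) X
    (Finset.disjoint_empty_left X) (by
      intro v hv N hN hadj hrank
      rw [Finset.empty_union] at hN
      exact hr v hv N hN hadj fun u hu => hrank u hu (hN hu))
  exact ⟨π, by simpa using hπ⟩

end Greedy

/-- The saving behind every greedy step: one untreated neighbour `x` leaves at most `d` treated
ones. -/
theorem DegreeLE.card_le {V : Type*} {G : SimpleGraph V} {d : ℕ} (hdeg : DegreeLE G (d + 1))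
    {v x : V} {N : Finset V} (hN : ∀ u ∈ N, G.Adj u v) (hx : G.Adj x v) (hxN : x ∉ N) :
    N.card ≤ d := by
  classical
  have := hdeg v (insert x N) (by
    intro u hu
    rcases Finset.mem_insert.1 hu with rfl | hu
    · exact hx
    · exact hN u hu)
  rw [Finset.card_insert_of_notMem hxN] at this
  omega

theorem SimpleGraph.Reachable.exists_adj_dist_add_one {V : Type*} {G : SimpleGraph V} {x w : V}
    (h : G.Reachable x w) (hne : x ≠ w) :
    ∃ y, G.Adj x y ∧ G.Reachable y w ∧ G.dist y w + 1 = G.dist x w := by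
  obtain ⟨p, hp⟩ := h.exists_walk_length_eq_dist
  cases p with
  | nil => exact absurd rfl hne
  | @cons _ y _ hxy p =>
    refine ⟨y, hxy, p.reachable, le_antisymm ?_ ?_⟩
    · rw [← hp, SimpleGraph.Walk.length_cons]
      exact Nat.add_le_add_right (SimpleGraph.dist_le p) 1
    · obtain ⟨q, hq⟩ := p.reachable.exists_walk_length_eq_dist
      rw [← hq, ← SimpleGraph.Walk.length_cons hxy q]
      exact SimpleGraph.dist_le _

section Connected

variable {V P : Type*} [Fintype V] [Nonempty P] {G : SimpleGraph V} {c : V → V → P → P → Prop}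

/-- Greedy choice of states in a connected graph, ending at a vertex of small degree. -/
theorem exists_compatible_of_root (hc : ∀ u v p q, c u v p q → c v u q p)
    (hconn : G.Connected) {d : ℕ} (hdeg : DegreeLE G (d + 1)) (hext : IsExtendable G c d) {s : V}
    (hs : ∀ N : Finset V, (∀ u ∈ N, G.Adj u s) → N.card ≤ d) :
    ∃ π : V → P, ∀ u v, G.Adj u v → c u v (π u) (π v) := by
  classical
  obtain ⟨π, hπ⟩ := exists_isCompatibleOn hc hext (fun x => G.dist x s) Finset.univ (by
    intro v _ N _ hN hrank
    by_cases hv : v = s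
    · exact hs N (hv ▸ hN)
    · obtain ⟨y, hvy, -, hy⟩ := (hconn.preconnected v s).exists_adj_dist_add_one hv
      exact hdeg.card_le hN hvy.symm fun hyN => by have := hrank y hyN; omega)
  exact ⟨π, fun u v => hπ u (Finset.mem_univ u) v (Finset.mem_univ v)⟩

/-- Greedy choice of states in a connected graph, with the states of the endpoints of one edge
chosen last and simultaneously. -/
theorem exists_compatible_of_edge (hc : ∀ u v p q, c u v p q → c v u q p)
    (hconn : G.Connected) {d : ℕ} (hdeg : DegreeLE G (d + 1)) (hext : IsExtendable G c d) {u v : V}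
    (huv : G.Adj u v)
    (hpair : ∀ π : V → P, ∃ p q, (∀ x, x ≠ v → G.Adj x u → c x u (π x) p) ∧
      (∀ x, x ≠ u → G.Adj x v → c x v (π x) q) ∧ c u v p q) :
    ∃ π : V → P, ∀ u v, G.Adj u v → c u v (π u) (π v) := by
  classical
  have hne := huv.ne
  obtain ⟨π, hπ⟩ := exists_isCompatibleOn hc hext (fun x => G.dist x v) {u, v}ᶜ (by
    intro x hx N _ hN hrank
    have hxv : x ≠ v := fun he => by simp [he] at hx
    obtain ⟨y, hxy, -, hy⟩ := (hconn.preconnected x v).exists_adj_dist_add_one hxv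
    exact hdeg.card_le hN hxy.symm fun hyN => by have := hrank y hyN; omega)
  obtain ⟨p, q, hp, hq, hpq⟩ := hpair π
  have h1 := hπ.insert hc (v := u) (p := p) (by simp) fun x hx hxu =>
    hp x (fun he => by simp [he] at hx) hxu
  have h2 := h1.insert hc (v := v) (p := q) (by simp [hne.symm]) fun x hx hxv => by
    by_cases hxu : x = u
    · subst hxu; rwa [Function.update_self]
    · rw [Function.update_of_ne hxu]; exact hq x hxu hxv
  refine ⟨_, fun x y => h2 x ?_ y ?_⟩ <;>
  · simp only [Finset.mem_insert, Finset.mem_compl, Finset.mem_singleton]; tauto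

end Connected

/-! ### Reduction to connected components. -/

theorem exists_compatible_of_connectedComponent {V P : Type*} {G : SimpleGraph V}
    {c : V → V → P → P → Prop}
    (h : ∀ C : G.ConnectedComponent, ∃ π : C → P, ∀ x y : C, C.toSimpleGraph.Adj x y →
      c x y (π x) (π y)) :
    ∃ π : V → P, ∀ u v, G.Adj u v → c u v (π u) (π v) := by
  choose π hπ using h
  refine ⟨fun v => π (G.connectedComponentMk v) ⟨v, rfl⟩, fun u v huv => ?_⟩
  -- The components of `u` and `v` are equal only propositionally; a variable `C` allows transport
  -- between them.
  have key : ∀ C, ∀ (hu : G.connectedComponentMk u = C) (hv : G.connectedComponentMk v = C),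
      c u v (π (G.connectedComponentMk u) ⟨u, rfl⟩) (π (G.connectedComponentMk v) ⟨v, rfl⟩) := by
    rintro C hu rfl
    have : π (G.connectedComponentMk u) ⟨u, rfl⟩ = π (G.connectedComponentMk v) ⟨u, hu⟩ := by
      clear huv
      generalize hD : G.connectedComponentMk v = D at hu
      subst hu
      rfl
    rw [this]
    exact hπ _ ⟨u, hu⟩ ⟨v, rfl⟩ huv
  exact key _ (SimpleGraph.ConnectedComponent.sound huv.reachable) rfl

theorem DegreeLE.toSimpleGraph {V : Type*} {G : SimpleGraph V} {d : ℕ} (hdeg : DegreeLE G d)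
    (C : G.ConnectedComponent) : DegreeLE C.toSimpleGraph d := by
  intro v N hN
  rw [← Finset.card_map (Function.Embedding.subtype _)]
  refine hdeg v _ fun u hu => ?_
  obtain ⟨x, hx, rfl⟩ := Finset.mem_map.1 hu
  exact hN x hx

/-! ### Partial matchings between colours -/

/-- `M u v` is a partial matching on `Fin k` for every edge `uv` of `G`. -/
structure IsMatchingFamily {V : Type*} {k : ℕ} (G : SimpleGraph V)
    (M : V → V → Fin k → Fin k → Prop) : Prop where
  symm : ∀ u v a b, M u v a b → M v u b a
  functional : ∀ u v a b b', G.Adj u v → M u v a b → M u v a b' → b = b'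

/-- The orders `p` and `q` of the colours at `u` and `v` have no conflict. -/
def Avoids {V : Type*} {k : ℕ} (M : V → V → Fin k → Fin k → Prop) (u v : V)
    (p q : Perm (Fin k)) : Prop :=
  ∀ i, ¬ M u v (p i) (q i)

namespace IsMatchingFamily

variable {V : Type*} {k : ℕ} {G : SimpleGraph V} {M : V → V → Fin k → Fin k → Prop}

theorem avoids_symm (hM : IsMatchingFamily G M) (u v : V) (p q : Perm (Fin k))
    (h : Avoids M u v p q) : Avoids M v u q p :=
  fun i hi => h i (hM.symm _ _ _ _ hi)

/-- Completing the matchings only adds conflicts, and turns the constraint from each neighbour into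
avoidance of a permutation. -/
theorem exists_completion (hM : IsMatchingFamily G M) :
    ∃ σ : V → V → Perm (Fin k), ∀ u v, G.Adj u v → ∀ a b, M u v a b → σ u v a = b := by
  classical
  have : ∀ u v, ∃ σ : Perm (Fin k), G.Adj u v → ∀ a b, M u v a b → σ a = b := by
    intro u v
    by_cases huv : G.Adj u v
    · set s : Finset (Fin k) := Finset.univ.filter fun a => ∃ b, M u v a b
      have hf : ∀ a, ∃ b, (∃ b, M u v a b) → M u v a b := fun a => by
        by_cases h : ∃ b, M u v a b
        · exact h.imp fun b hb _ => hb
        · exact ⟨a, fun h' => absurd h' h⟩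
      choose f hf using hf
      obtain ⟨g, hg⟩ := Finset.exists_equiv_extend_of_card_eq (t := (Finset.univ : Finset (Fin k)))
        (s := s) (f := f) (by simp) (Finset.subset_univ _) (by
          intro a ha b hb hab
          have ha' := hf a (by simpa [s] using ha)
          have hb' := hf b (by simpa [s] using hb)
          rw [← hab] at hb'
          exact hM.functional v u _ _ _ huv.symm (hM.symm _ _ _ _ ha') (hM.symm _ _ _ _ hb'))
      refine ⟨g.trans (Equiv.subtypeUnivEquiv fun x => Finset.mem_univ x), fun _ a b hab => ?_⟩
      have := hg a (by simpa [s] using ⟨b, hab⟩)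
      exact this.trans (hM.functional u v _ _ _ huv (hf a ⟨b, hab⟩) hab)
    · exact ⟨1, fun h => absurd h huv⟩
  choose σ hσ using this
  exact ⟨σ, hσ⟩

theorem isExtendable (hM : IsMatchingFamily G M) {d : ℕ} (hd : 2 * d ≤ k) :
    IsExtendable G (Avoids M) d := by
  classical
  obtain ⟨σ, hσ⟩ := hM.exists_completion
  intro v N π hN hcard
  obtain ⟨p, hp⟩ := exists_perm_avoiding (n := k) (d := N.card) (by omega)
    fun j => σ (N.equivFin.symm j) v * π (N.equivFin.symm j)
  refine ⟨p, fun u hu i hi => hp (N.equivFin ⟨u, hu⟩) i ?_⟩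
  simpa using (hσ u v (hN u hu) _ _ hi).symm

end IsMatchingFamily

theorem exists_fin_cover {α β : Type*} [Nonempty β] {N : Finset α} {d : ℕ} (h : N.card ≤ d)
    (φ : α → β) : ∃ f : Fin d → β, ∀ x ∈ N, ∃ j, f j = φ x := by
  classical
  refine ⟨fun j => if hj : j.1 < N.card then φ (N.equivFin.symm ⟨j, hj⟩) else Classical.arbitrary β,
    fun x hx => ⟨⟨N.equivFin ⟨x, hx⟩, (N.equivFin ⟨x, hx⟩).2.trans_le h⟩, ?_⟩⟩
  simp

theorem exists_fin_cover_neighbors {V β : Type*} [Fintype V] [Nonempty β] {G : SimpleGraph V}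
    {d : ℕ} (hdeg : DegreeLE G (d + 1)) {u v : V} (huv : G.Adj v u) (φ : V → β) :
    ∃ f : Fin d → β, ∀ x, x ≠ v → G.Adj x u → ∃ j, f j = φ x := by
  classical
  obtain ⟨f, hf⟩ := exists_fin_cover (N := Finset.univ.filter fun x => x ≠ v ∧ G.Adj x u) (d := d)
    (hdeg.card_le (v := u) (x := v) (fun x hx => (Finset.mem_filter.1 hx).2.2) huv (by simp)) φ
  exact ⟨f, fun x hx hxu => hf x (by simp [hx, hxu])⟩

/-! ### Maximum degree four with six colours. -/

theorem exists_avoids_six_of_connected {V : Type*} [Fintype V] {G : SimpleGraph V}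
    (hconn : G.Connected) (hdeg : DegreeLE G 4) {M : V → V → Fin 6 → Fin 6 → Prop}
    (hM : IsMatchingFamily G M) :
    ∃ π : V → Perm (Fin 6), ∀ u v, G.Adj u v → Avoids M u v (π u) (π v) := by
  classical
  by_cases hE : ∃ u v, G.Adj u v
  · obtain ⟨u, v, huv⟩ := hE
    obtain ⟨σ, hσ⟩ := hM.exists_completion
    refine exists_compatible_of_edge hM.avoids_symm hconn hdeg (hM.isExtendable (by norm_num)) huv
      fun π => ?_
    obtain ⟨f, hf⟩ := exists_fin_cover_neighbors hdeg huv.symm fun x => σ x u * π x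
    obtain ⟨g, hg⟩ := exists_fin_cover_neighbors hdeg huv fun x => σ x v * π x
    -- The order at `u` is transported by `σ u v` to the colours of `v`, so that compatibility along
    -- `uv` becomes plain disjointness.
    obtain ⟨p, q, hp, hq, hpq⟩ := exists_disjoint_pair_avoiding (fun j => σ u v * f j) g
    refine ⟨(σ u v)⁻¹ * p, q, fun x hx hxu i hi => ?_, fun x hx hxv i hi => ?_, fun i hi => ?_⟩
    · obtain ⟨j, hj⟩ := hf x hx hxu
      refine hp j i ?_
      rw [hj]
      simp [hσ x u hxu _ _ hi]
    · obtain ⟨j, hj⟩ := hg x hx hxv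
      refine hq j i ?_
      rw [hj]
      exact (hσ x v hxv _ _ hi).symm
    · refine hpq i ?_
      simpa using (hσ u v huv _ _ hi).symm
  · exact ⟨fun _ => 1, fun u v huv => absurd ⟨u, v, huv⟩ hE⟩

/-! ### Maximum degree three with four colours. -/

/-- The vertices of a shortest path from `v` to `y`. -/
theorem SimpleGraph.Reachable.exists_geodesic {V : Type*} {G : SimpleGraph V} {v y : V}
    (h : G.Reachable v y) :
    ∃ Y : Finset V, v ∈ Y ∧ y ∈ Y ∧ (∀ x ∈ Y, G.Reachable x y) ∧
      (∀ x ∈ Y, G.dist x y ≤ G.dist v y) ∧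
      (∀ x ∈ Y, x ≠ v → ∃ x' ∈ Y, G.Adj x x' ∧ G.dist x' y = G.dist x y + 1) ∧
      ∀ x ∈ Y, ∀ x' ∈ Y, G.dist x y = G.dist x' y → x = x' := by
  classical
  induction hn : G.dist v y generalizing v with
  | zero =>
    obtain rfl : v = y := h.dist_eq_zero_iff.1 hn
    exact ⟨{v}, by simp, by simp, by simp, by simp, by simp, by simp⟩
  | succ n ih =>
    have hne : v ≠ y := by rintro rfl; simp at hn
    obtain ⟨x, hvx, hx, hd⟩ := h.exists_adj_dist_add_one hne
    obtain ⟨Y, hxY, hyY, hr, hle, hs, hinj⟩ := ih hx (by omega)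
    refine ⟨insert v Y, by simp, by simp [hyY], ?_, ?_, ?_, ?_⟩
    · intro z hz
      rcases Finset.mem_insert.1 hz with rfl | hz
      · exact h
      · exact hr z hz
    · intro z hz
      rcases Finset.mem_insert.1 hz with rfl | hz
      · omega
      · exact (hle z hz).trans (Nat.le_succ n)
    · intro z hz hzv
      have hz := (Finset.mem_insert.1 hz).resolve_left hzv
      by_cases hzx : z = x
      · exact ⟨v, by simp, by rw [hzx]; exact hvx.symm, by rw [hzx]; omega⟩
      · obtain ⟨x', hx', hadj, hd'⟩ := hs z hz hzx
        exact ⟨x', by simp [hx'], hadj, hd'⟩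
    · intro z hz₀ z' hz₀' he
      rcases Finset.mem_insert.1 hz₀ with rfl | hz <;>
        rcases Finset.mem_insert.1 hz₀' with rfl | hz'
      · rfl
      · have := hle z' hz'; omega
      · have := hle z hz; omega
      · exact hinj z hz z' hz' he

/-- A vertex of a finite connected graph at maximum distance from `v₀` is not a cut vertex. -/
theorem exists_reachable_avoiding {V : Type*} [Fintype V] {G : SimpleGraph V}
    (hconn : G.Connected) (hdeg : ∀ v, ∃ x, G.Adj x v) :
    ∃ (w : V) (G' : SimpleGraph V), (∀ x y, G'.Adj x y ↔ G.Adj x y ∧ x ≠ w ∧ y ≠ w) ∧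
      ∀ x y, x ≠ w → y ≠ w → G'.Reachable x y := by
  classical
  obtain ⟨v₀⟩ := hconn.nonempty
  obtain ⟨w, -, hw⟩ := Finset.exists_max_image Finset.univ (fun x => G.dist x v₀)
    ⟨v₀, Finset.mem_univ v₀⟩
  have hw₀ : w ≠ v₀ := by
    rintro rfl
    obtain ⟨x, hx⟩ := hdeg w
    have h1 := hw x (Finset.mem_univ x)
    rw [SimpleGraph.dist_self, SimpleGraph.dist_eq_one_iff_adj.2 hx] at h1
    omega
  let G' : SimpleGraph V :=
    { Adj := fun x y => G.Adj x y ∧ x ≠ w ∧ y ≠ w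
      symm := ⟨fun x y h => ⟨h.1.symm, h.2.2, h.2.1⟩⟩
      loopless := ⟨fun x h => G.irrefl h.1⟩ }
  have hreach : ∀ n x, G.dist x v₀ = n → x ≠ w → G'.Reachable x v₀ := by
    intro n
    induction n with
    | zero =>
      intro x hx _
      rw [(hconn.dist_eq_zero_iff).1 hx]
    | succ n ih =>
      intro x hx hxw
      have hne : x ≠ v₀ := by rintro rfl; simp at hx
      obtain ⟨y, hxy, -, hy⟩ := (hconn.preconnected x v₀).exists_adj_dist_add_one hne
      have hyw : y ≠ w := by
        rintro rfl
        have := hw x (Finset.mem_univ x)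
        omega
      exact (SimpleGraph.Adj.reachable (G := G') ⟨hxy, hxw, hyw⟩).trans (ih y (by omega) hyw)
  exact ⟨w, G', fun _ _ => Iff.rfl, fun x y hx hy =>
    (hreach _ x rfl hx).trans (hreach _ y rfl hy).symm⟩

theorem exists_avoids_four_of_connected {V : Type*} [Fintype V] {G : SimpleGraph V}
    (hconn : G.Connected) (hdeg : DegreeLE G 3) {M : V → V → Fin 4 → Fin 4 → Prop}
    (hM : IsMatchingFamily G M) :
    ∃ π : V → Perm (Fin 4), ∀ u v, G.Adj u v → Avoids M u v (π u) (π v) := by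
  classical
  have hext : IsExtendable G (Avoids M) 2 := hM.isExtendable (by norm_num)
  by_cases hs : ∃ s, ∀ N : Finset V, (∀ u ∈ N, G.Adj u s) → N.card ≤ 2
  · obtain ⟨s, hs⟩ := hs
    exact exists_compatible_of_root hM.avoids_symm hconn hdeg hext hs
  push Not at hs
  obtain ⟨σ, hσ⟩ := hM.exists_completion
  obtain ⟨w, G', hG', hreach⟩ := exists_reachable_avoiding hconn fun v => by
    obtain ⟨N, hN, hcard⟩ := hs v
    obtain ⟨x, hx⟩ := Finset.card_pos.1 (show 0 < N.card by omega)
    exact ⟨x, hN x hx⟩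
  obtain ⟨Nw, hNw, hNwc⟩ := hs w
  obtain ⟨v, hv, y, hy, hvy⟩ := Finset.one_lt_card.1 (show 1 < Nw.card by omega)
  have hvw := hNw v hv
  have hyw := hNw y hy
  obtain ⟨Y, hvY, hyY, hYr, hYle, hYs, hYinj⟩ := (hreach v y hvw.ne hyw.ne).exists_geodesic
  have hwY : w ∉ Y := by
    intro hwY
    obtain ⟨x', -, hadj, -⟩ := hYs w hwY hvw.ne'
    exact ((hG' _ _).1 hadj).2.1 rfl
  -- As `Y` is a geodesic starting at `v`, it contains at most one neighbour of `v`; with `w` this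
  -- accounts for two of the three.
  obtain ⟨z, hzv, hzw, hzY⟩ : ∃ z, G.Adj z v ∧ z ≠ w ∧ z ∉ Y := by
    obtain ⟨Nv, hNv, hNvc⟩ := hs v
    by_contra hcon
    push Not at hcon
    have hone : (Nv.filter (· ∈ Y)).card ≤ 1 := by
      have hd : ∀ x ∈ Nv.filter (· ∈ Y), G'.dist x y + 1 = G'.dist v y := by
        intro x hx
        rw [Finset.mem_filter] at hx
        have hxv := hNv x hx.1
        have hxw : x ≠ w := fun he => hwY (he ▸ hx.2)
        have hadj : G'.Adj v x := (hG' _ _).2 ⟨hxv.symm, hvw.ne, hxw⟩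
        have h1 := hYle x hx.2
        have h2 : G'.dist x y ≠ G'.dist v y := fun he => hxv.ne (hYinj x hx.2 v hvY he)
        have h3 : G'.dist v y ≤ G'.dist x y + 1 := by
          obtain ⟨q, hq⟩ := (hYr x hx.2).exists_walk_length_eq_dist
          rw [← hq, ← SimpleGraph.Walk.length_cons hadj q]
          exact SimpleGraph.dist_le _
        omega
      rw [Finset.card_le_one]
      intro a ha b hb
      have h1 := hd a ha
      have h2 := hd b hb
      exact hYinj a (Finset.mem_filter.1 ha).2 b (Finset.mem_filter.1 hb).2 (by omega)
    have hsub : Nv ⊆ insert w (Nv.filter (· ∈ Y)) := by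
      intro x hx
      by_cases hxw : x = w
      · simp [hxw]
      · simp [hx, hcon x (hNv x hx) hxw]
    have := (Finset.card_le_card hsub).trans (Finset.card_insert_le _ _)
    omega
  -- The order of treatment is `X` towards `w`, then `w`, then the geodesic from `y` back towards
  -- `v`, and `v` last.
  set X : Finset V := (insert w Y)ᶜ with hX
  have hmemX : ∀ x, x ∈ X ↔ x ≠ w ∧ x ∉ Y := fun x => by simp [hX]
  obtain ⟨π₀, hπ₀⟩ := exists_isCompatibleOn hM.avoids_symm hext (fun x => G.dist x w) X (by
    intro x hx N _ hN hrank
    obtain ⟨x', hxx', -, hd⟩ :=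
      (hconn.preconnected x w).exists_adj_dist_add_one ((hmemX x).1 hx).1
    exact hdeg.card_le hN hxx'.symm fun h => by have := hrank x' h; omega)
  -- The neighbours `v` and `y` of `w` lie on the geodesic, so at most one neighbour is in `X`.
  obtain ⟨f, hf⟩ : ∃ f : Perm (Fin 4), ∀ x ∈ X, G.Adj x w → f = σ x w * π₀ x := by
    obtain ⟨f, hf⟩ := exists_fin_cover (N := X.filter fun x => G.Adj x w) (d := 1) (by
      have hadj : ∀ x ∈ X.filter fun x => G.Adj x w, G.Adj x w :=
        fun x hx => (Finset.mem_filter.1 hx).2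
      have hcard : (insert y (X.filter fun x => G.Adj x w)).card ≤ 2 := by
        refine hdeg.card_le (v := w) (x := v) (fun x hx => ?_) hvw ?_
        · rcases Finset.mem_insert.1 hx with rfl | hx
          · exact hyw
          · exact hadj x hx
        · simp [hvy, hmemX, hvY]
      rw [Finset.card_insert_of_notMem (by simp [hmemX, hyY])] at hcard
      omega) fun x => σ x w * π₀ x
    refine ⟨f 0, fun x hx hxw => ?_⟩
    obtain ⟨j, hj⟩ := hf x (Finset.mem_filter.2 ⟨hx, hxw⟩)
    rwa [Subsingleton.elim 0 j]
  -- The state of `w`, seen at `v`, is chosen against that of `z`, so that the unknown third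
  -- neighbour of `v` cannot block it.
  obtain ⟨p, hpf, hp⟩ := exists_perm_avoiding_extendable (σ z v * π₀ z) (σ w v * f)
  have h₁ := hπ₀.insert hM.avoids_symm (v := w) (p := (σ w v)⁻¹ * p) (by simp [hmemX])
    fun x hx hxw i hi => hpf i (by
      have := hσ x w hxw _ _ hi
      rw [hf x hx hxw, Equiv.Perm.mul_apply, Equiv.Perm.mul_apply, this]
      simp)
  obtain ⟨π₂, hπ₂, h₂⟩ := h₁.exists_extension hM.avoids_symm hext
    -- Decreasing rank runs from `y` to `v`; the subtraction is never truncated, since distances on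
    -- the geodesic are at most `G'.dist v y`.
    (fun x => G'.dist v y - G'.dist x y) (Y.erase v) (by
      rw [Finset.disjoint_left]
      intro x hx hxY
      rcases Finset.mem_insert.1 hx with rfl | hx
      · exact hwY (Finset.mem_of_mem_erase hxY)
      · exact ((hmemX x).1 hx).2 (Finset.mem_of_mem_erase hxY)) (by
      intro x hx N hNsub hN hrank
      rw [Finset.mem_erase] at hx
      obtain ⟨x', hx'Y, hadj, hd⟩ := hYs x hx.2 hx.1
      have hle := hYle x' hx'Y
      refine hdeg.card_le hN ((hG' _ _).1 hadj).1.symm fun hx'N => ?_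
      rcases Finset.mem_union.1 (hNsub hx'N) with h | h
      · rcases Finset.mem_insert.1 h with rfl | h
        · exact hwY hx'Y
        · exact ((hmemX x').1 h).2 hx'Y
      · have := hrank x' hx'N h
        omega)
  have hzX : z ∈ X := (hmemX z).2 ⟨hzw, hzY⟩
  have hz₂ : π₂ z = π₀ z := by
    rw [hπ₂ z (Finset.mem_insert_of_mem hzX), Function.update_of_ne hzw]
  have hw₂ : π₂ w = (σ w v)⁻¹ * p := by
    rw [hπ₂ w (Finset.mem_insert_self w X), Function.update_self]
  obtain ⟨g, hg⟩ : ∃ g : Perm (Fin 4), ∀ x, G.Adj x v → x ≠ z → x ≠ w → g = σ x v * π₂ x := by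
    obtain ⟨g, hg⟩ := exists_fin_cover
      (N := Finset.univ.filter fun x => G.Adj x v ∧ x ≠ z ∧ x ≠ w) (d := 1) (by
      have hcard : (insert z (Finset.univ.filter fun x => G.Adj x v ∧ x ≠ z ∧ x ≠ w)).card ≤ 2 := by
        refine hdeg.card_le (v := v) (x := w) (fun x hx => ?_) hvw.symm ?_
        · rcases Finset.mem_insert.1 hx with rfl | hx
          · exact hzv
          · exact (Finset.mem_filter.1 hx).2.1
        · simp [hzw.symm]
      rw [Finset.card_insert_of_notMem (by simp)] at hcard
      omega) fun x => σ x v * π₂ x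
    refine ⟨g 0, fun x hxv hxz hxw => ?_⟩
    obtain ⟨j, hj⟩ := hg x (by simp [hxv, hxz, hxw])
    rwa [Subsingleton.elim 0 j]
  obtain ⟨q, hq⟩ := hp g
  have h₃ := h₂.insert hM.avoids_symm (v := v) (p := q) (by simp [hmemX, hvY, hvw.ne])
    fun x _ hxv i hi => by
      have hx := hσ x v hxv _ _ hi
      by_cases hxz : x = z
      · subst hxz
        exact (hq i).1 (by rw [← hx, hz₂]; rfl)
      · by_cases hxw : x = w
        · subst hxw
          exact (hq i).2.1 (by rw [← hx, hw₂]; simp)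
        · exact (hq i).2.2 (by rw [← hx, hg x hxv hxz hxw]; rfl)
  have hmem : ∀ x, x ∈ insert v (insert w X ∪ Y.erase v) := by
    intro x
    simp only [Finset.mem_insert, Finset.mem_union, Finset.mem_erase, hmemX]
    tauto
  exact ⟨_, fun x x' => h₃ x (hmem x) x' (hmem x')⟩

/-! ### Lists of three colours -/

/-- Lists `e v` of three distinct colours on a connected graph of maximum degree at most two can be
ordered such that adjacent vertices have different colours in every position. -/
theorem exists_avoids_three_of_connected {V : Type*} [Fintype V] {G : SimpleGraph V}
    (hconn : G.Connected) (hdeg : DegreeLE G 2) (e : V → Fin 3 → ℕ)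
    (he : ∀ v, Function.Injective (e v)) :
    ∃ π : V → Perm (Fin 3), ∀ u v, G.Adj u v →
      Avoids (fun u v a b => e u a = e v b) u v (π u) (π v) := by
  classical
  have hM : IsMatchingFamily G (fun u v a b => e u a = e v b) :=
    ⟨fun _ _ _ _ h => h.symm, fun _ v _ _ _ _ h h' => he v (h.symm.trans h')⟩
  have hext : IsExtendable G (Avoids fun u v a b => e u a = e v b) 1 :=
    hM.isExtendable (by norm_num)
  by_cases hsame : ∀ w v, G.Adj w v → ∀ b, ∃ a, e w a = e v b
  · obtain ⟨v₀⟩ := hconn.nonempty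
    have hall : ∀ v, ∀ b, ∃ a, e v a = e v₀ b := by
      intro v
      obtain ⟨p⟩ := hconn.preconnected v v₀
      induction p with
      | nil => exact fun b => ⟨b, rfl⟩
      | cons h p ih =>
        intro b
        obtain ⟨a, ha⟩ := ih b
        obtain ⟨a', ha'⟩ := hsame _ _ h a
        exact ⟨a', ha'.trans ha⟩
    choose τ hτ using hall
    have hτinj : ∀ v, Function.Injective (τ v) := fun v a b hab =>
      he v₀ (by rw [← hτ v a, ← hτ v b, hab])
    obtain ⟨h, hh⟩ := exists_isCompatibleOn (G := G) (P := Fin 3) (c := fun _ _ a b => a ≠ b)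
      (d := 2) (fun _ _ _ _ h => h.symm) (by
        intro v N π _ hN
        obtain ⟨p, hp⟩ : ∃ p, p ∉ N.image π := by
          by_contra hcon
          push Not at hcon
          have h1 := Finset.card_le_card (fun x _ => hcon x : Finset.univ ⊆ N.image π)
          have h2 := Finset.card_image_le (s := N) (f := π)
          simp only [Finset.card_univ, Fintype.card_fin] at h1
          omega
        exact ⟨p, fun u hu hup => hp (hup ▸ Finset.mem_image_of_mem π hu)⟩)
      (fun _ => 0) Finset.univ (fun v _ N _ hN _ => hdeg v N hN)
    -- With one common list, position `i` at `v` gets colour number `h v + i`; adjacent vertices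
    -- have different shifts.
    refine ⟨fun v => Equiv.addLeft (h v) |>.trans
      (Equiv.ofBijective (τ v) (Finite.injective_iff_bijective.1 (hτinj v))), fun u v huv i hi => ?_⟩
    have hi' : e u (τ u (h u + i)) = e v (τ v (h v + i)) := hi
    rw [hτ, hτ] at hi'
    exact hh u (Finset.mem_univ u) v (Finset.mem_univ v) huv (add_right_cancel (he v₀ hi'))
  push Not at hsame
  obtain ⟨w, v, hwv, b, hb⟩ := hsame
  by_cases hy : ∃ y, y ≠ w ∧ G.Adj y v
  · obtain ⟨y, hyw, hyv⟩ := hy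
    obtain ⟨σ, hσ⟩ := hM.exists_completion
    refine exists_compatible_of_edge hM.avoids_symm hconn hdeg hext hyv fun π => ?_
    obtain ⟨f, hf⟩ := exists_fin_cover_neighbors hdeg hyv.symm fun x => σ x y * π x
    have hw : ∀ x, x ≠ y → G.Adj x v → x = w := by
      intro x hxy hxv
      by_contra hxw
      have := hdeg v {x, y, w} (by
        intro u hu
        simp only [Finset.mem_insert, Finset.mem_singleton] at hu
        rcases hu with rfl | rfl | rfl <;> assumption)
      rw [Finset.card_eq_three.2 ⟨x, y, w, hxy, hxw, hyw, rfl⟩] at this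
      omega
    -- The exempt position is the one where the completed matching from `w` yields `b`. No real
    -- conflict occurs there, because `b` is not in the list of `w`.
    obtain ⟨p, q, hp, hpq, hq⟩ := exists_pair_avoiding_of_missing_cell (σ y v * f 0)
      (σ w v * π w) ((σ w v * π w)⁻¹ b)
    refine ⟨(σ y v)⁻¹ * p, q, fun x hx hxy i hi => ?_, fun x hx hxv i hi => ?_, fun i hi => ?_⟩
    · obtain ⟨j, hj⟩ := hf x hx hxy
      refine hp i ?_
      rw [Subsingleton.elim 0 j, hj]
      simp [hσ x y hxy _ _ hi]
    · obtain rfl := hw x hx hxv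
      have hi' := hσ x v hxv _ _ hi
      by_cases hib : i = (σ x v * π x)⁻¹ b
      · have : q i = b := by
          rw [← hi', hib]
          exact (σ x v * π x).apply_symm_apply b
        exact hb (π x i) (this ▸ hi)
      · exact hq i hib hi'.symm
    · exact hpq i (by simpa using (hσ y v hyv _ _ hi).symm)
  · push Not at hy
    refine exists_compatible_of_root hM.avoids_symm hconn hdeg hext (s := v) fun N hN => ?_
    rw [Finset.card_le_one]
    intro x hx x' hx'
    have key : ∀ x ∈ N, x = w := fun x hx => by
      by_contra hxw
      exact hy x hxw (hN x hx)
    rw [key x hx, key x' hx']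

/-! ### Reduction of packings to orders of the lists -/

theorem hasCoverPacking_of_avoids {V W : Type u} [Fintype V] {G : SimpleGraph V}
    {H : SimpleGraph W} {L : V → Finset W} {k : ℕ} (hL : IsCorrespondenceCover G H L)
    (hk : ∀ v, (L v).card = k)
    (h : ∀ M : V → V → Fin k → Fin k → Prop, IsMatchingFamily G M →
      ∃ π : V → Perm (Fin k), ∀ u v, G.Adj u v → Avoids M u v (π u) (π v)) :
    HasCoverPacking G H k := by
  classical
  let e : ∀ v, L v ≃ Fin k := fun v => (L v).equivFinOfCardEq (hk v)
  obtain ⟨π, hπ⟩ := h (fun u v a b => H.Adj ((e u).symm a) ((e v).symm b))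
    ⟨fun _ _ _ _ h => h.symm, fun u v a b b' huv h h' => (e v).symm.injective (Subtype.ext
      (hL.matching_of_adj u v huv _ ((e u).symm a).2 _ ((e v).symm b).2 _ ((e v).symm b').2 h h'))⟩
  have huniq : ∀ {x : W} {u v : V}, x ∈ L u → x ∈ L v → u = v := fun hu hv =>
    (hL.partition _).unique hu hv
  have hmem : ∀ v i, ((e v).symm (π v i) : W) ∈ L v := fun v i => ((e v).symm (π v i)).2
  refine ⟨fun i => Finset.univ.image fun v => ((e v).symm (π v i) : W), fun i => ⟨?_, ?_⟩, ?_⟩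
  · intro x hx y hy hxy hadj
    simp only [Finset.coe_image, Finset.coe_univ, Set.image_univ, Set.mem_range] at hx hy
    obtain ⟨u, rfl⟩ := hx
    obtain ⟨v, rfl⟩ := hy
    by_cases huv : u = v
    · subst huv; exact hxy rfl
    · by_cases hG : G.Adj u v
      · exact hπ u v hG i hadj
      · exact hL.empty_of_not_adj u v huv hG _ (hmem u i) _ (hmem v i) hadj
  · rw [Finset.card_image_of_injective, Finset.card_univ]
    intro u v huv
    have huv' : ((e u).symm (π u i) : W) = (e v).symm (π v i) := huv
    exact huniq (hmem u i) (huv' ▸ hmem v i)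
  · intro x
    obtain ⟨v, hv, -⟩ := hL.partition x
    refine ⟨(π v)⁻¹ (e v ⟨x, hv⟩), ?_, ?_⟩
    · simp only [Finset.mem_image, Finset.mem_univ, true_and]
      exact ⟨v, by simp⟩
    · intro i hi
      simp only [Finset.mem_image, Finset.mem_univ, true_and] at hi
      obtain ⟨u, hu⟩ := hi
      obtain rfl := huniq (hu ▸ hmem u i : x ∈ L u) hv
      have : (e u).symm (π u i) = ⟨x, hv⟩ := Subtype.ext hu
      rw [← this]
      simp

theorem correspondencePackingNumber_le {V : Type u} [Fintype V] {G : SimpleGraph V} {k : ℕ}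
    (hk : 0 < k)
    (h : ∀ M : V → V → Fin k → Fin k → Prop, IsMatchingFamily G M →
      ∃ π : V → Perm (Fin k), ∀ u v, G.Adj u v → Avoids M u v (π u) (π v)) :
    correspondencePackingNumber G ≤ k :=
  sInf_le ⟨k, rfl, hk, fun _ _ _ hL hLk => hasCoverPacking_of_avoids hL hLk h⟩

theorem IsMatchingFamily.toSimpleGraph {V : Type*} {k : ℕ} {G : SimpleGraph V}
    {M : V → V → Fin k → Fin k → Prop} (hM : IsMatchingFamily G M) (C : G.ConnectedComponent) :
    IsMatchingFamily C.toSimpleGraph (fun u v => M u v) :=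
  ⟨fun _ _ _ _ h => hM.symm _ _ _ _ h, fun u v a b b' huv h h' =>
    hM.functional u v a b b' huv h h'⟩

theorem degreeLE_of_maxDegree_le {V : Type*} [Fintype V] {G : SimpleGraph V} [DecidableRel G.Adj]
    {d : ℕ} (h : G.maxDegree ≤ d) : DegreeLE G d := by
  intro v N hN
  refine le_trans ?_ ((G.degree_le_maxDegree v).trans h)
  rw [← SimpleGraph.card_neighborFinset_eq_degree]
  exact Finset.card_le_card fun u hu => by simpa using (hN u hu).symm

theorem correspondencePackingNumber_le_four {V : Type u} [Fintype V] {G : SimpleGraph V}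
    (hdeg : DegreeLE G 3) : correspondencePackingNumber G ≤ 4 := by
  classical
  exact correspondencePackingNumber_le (k := 4) (by norm_num) fun M hM =>
    exists_compatible_of_connectedComponent fun C =>
      exists_avoids_four_of_connected C.connected_toSimpleGraph (hdeg.toSimpleGraph C)
        (hM.toSimpleGraph C)

theorem correspondencePackingNumber_le_six {V : Type u} [Fintype V] {G : SimpleGraph V}
    (hdeg : DegreeLE G 4) : correspondencePackingNumber G ≤ 6 := by
  classical
  exact correspondencePackingNumber_le (k := 6) (by norm_num) fun M hM =>
    exists_compatible_of_connectedComponent fun C =>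
      exists_avoids_six_of_connected C.connected_toSimpleGraph (hdeg.toSimpleGraph C)
        (hM.toSimpleGraph C)

theorem listPackingNumber_le_three {V : Type u} [Fintype V] {G : SimpleGraph V}
    (hdeg : DegreeLE G 2) : listPackingNumber G ≤ 3 := by
  classical
  refine sInf_le ⟨3, rfl, by norm_num, fun L hL => ?_⟩
  let e : ∀ v, L v ≃ Fin 3 := fun v => (L v).equivFinOfCardEq (hL v)
  obtain ⟨π, hπ⟩ := exists_compatible_of_connectedComponent (G := G) (P := Perm (Fin 3))
    (c := Avoids fun u v a b => ((e u).symm a : ℕ) = (e v).symm b) fun C =>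
      exists_avoids_three_of_connected C.connected_toSimpleGraph (hdeg.toSimpleGraph C)
        (fun v a => ((e v).symm a : ℕ))
        fun v => Subtype.val_injective.comp (e v).symm.injective
  refine ⟨fun i v => (e v).symm (π v i), fun i => ⟨fun v => ((e v).symm (π v i)).2,
    fun v w hvw => hπ v w hvw i⟩, fun i j hij v h => hij ?_⟩
  exact (π v).injective ((e v).symm.injective (Subtype.ext h))

/-! ### Comparison of list packing with correspondence packing. -/

/-- The cover graph of the correspondence-cover induced by a list-assignment. -/
def listCoverGraph {V : Type u} (G : SimpleGraph V) (L : V → Finset ℕ) :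
    SimpleGraph (Σ v, L v) where
  Adj x y := x ≠ y ∧ (x.1 = y.1 ∨ G.Adj x.1 y.1 ∧ (x.2 : ℕ) = y.2)
  symm := ⟨fun _ _ h => ⟨h.1.symm, h.2.imp Eq.symm fun h => ⟨h.1.symm, h.2.symm⟩⟩⟩
  loopless := ⟨fun _ h => h.1 rfl⟩

/-- An independent set meets each list at most once because lists are cliques; having `|V|` elements
it meets each exactly once, and so reads off a colouring. -/
theorem HasCoverPacking.hasListPacking {V : Type u} [Fintype V] {G : SimpleGraph V}
    {L : V → Finset ℕ} {k : ℕ} (h : HasCoverPacking G (listCoverGraph G L) k) :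
    HasListPacking G L k := by
  classical
  obtain ⟨I, hI, huniq⟩ := h
  have hinj : ∀ i, Set.InjOn (fun x : Σ v, L v => x.1) (I i) := by
    intro i x hx y hy hxy
    by_contra hne
    exact (hI i).1 hx hy hne ⟨hne, Or.inl hxy⟩
  have hsurj : ∀ i v, ∃ c : L v, (⟨v, c⟩ : Σ v, L v) ∈ I i := by
    intro i v
    have himg : (I i).image (fun x => x.1) = Finset.univ := by
      rw [← Finset.card_eq_iff_eq_univ, Finset.card_image_of_injOn (hinj i), (hI i).2]
    obtain ⟨⟨v, c⟩, hx, rfl⟩ := Finset.mem_image.1 (himg ▸ Finset.mem_univ v)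
    exact ⟨c, hx⟩
  choose c hc using hsurj
  refine ⟨fun i v => c i v, fun i => ⟨fun v => (c i v).2, fun v w hvw heq => ?_⟩,
    fun i j hij v heq => hij ?_⟩
  · have hne : (⟨v, c i v⟩ : Σ v, L v) ≠ ⟨w, c i w⟩ := fun h => hvw.ne (congrArg Sigma.fst h)
    exact (hI i).1 (hc i v) (hc i w) hne ⟨hne, Or.inr ⟨hvw, heq⟩⟩
  · have : c i v = c j v := Subtype.ext heq
    exact (huniq ⟨v, c i v⟩).unique (hc i v) (this ▸ hc j v)

theorem isCorrespondenceCover_listCoverGraph {V : Type u} [Fintype V] [DecidableEq V]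
    (G : SimpleGraph V) (L : V → Finset ℕ) :
    IsCorrespondenceCover G (listCoverGraph G L)
      fun v => (Finset.univ : Finset (L v)).map (Function.Embedding.sigmaMk v) := by
  have hmem : ∀ (x : Σ v, L v) v,
      x ∈ (Finset.univ : Finset (L v)).map (Function.Embedding.sigmaMk v) ↔ x.1 = v := by
    intro x v
    simp only [Finset.mem_map, Finset.mem_univ, true_and]
    constructor
    · rintro ⟨c, rfl⟩; rfl
    · rintro rfl; exact ⟨x.2, rfl⟩
  refine ⟨fun x => ⟨x.1, (hmem x _).2 rfl, fun v hv => ((hmem x v).1 hv).symm⟩, ?_, ?_, ?_⟩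
  · intro u v huv hG x hx y hy hadj
    obtain rfl := (hmem x u).1 hx
    obtain rfl := (hmem y v).1 hy
    exact hadj.2.elim huv fun h => hG h.1
  · intro u v huv x hx y hy z hz hxy hxz
    obtain rfl := (hmem x u).1 hx
    obtain ⟨w, c⟩ := y
    obtain ⟨w', c'⟩ := z
    obtain rfl : w = v := (hmem _ v).1 hy
    obtain rfl : w' = w := (hmem _ w).1 hz
    have h1 := (hxy.2.resolve_left huv.ne).2
    have h2 := (hxz.2.resolve_left huv.ne).2
    rw [show c = c' from Subtype.ext (h1.symm.trans h2)]
  · intro v x hx y hy hne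
    exact ⟨hne, Or.inl (((hmem x v).1 hx).trans ((hmem y v).1 hy).symm)⟩

theorem listPackingNumber_le_correspondencePackingNumber {V : Type u} [Fintype V]
    (G : SimpleGraph V) : listPackingNumber G ≤ correspondencePackingNumber G := by
  classical
  refine sInf_le_sInf ?_
  rintro n ⟨k, rfl, hk, h⟩
  refine ⟨k, rfl, hk, fun L hL => HasCoverPacking.hasListPacking ?_⟩
  exact h _ _ _ (isCorrespondenceCover_listCoverGraph G L) fun v => by simpa using hL v

theorem theorem1p4 {V : Type u} [Fintype V] (G : SimpleGraph V) [DecidableRel G.Adj] :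
    ((G.maxDegree = 2 ∨ G.maxDegree = 3) →
      listPackingNumber G ≤ (G.maxDegree : ℕ∞) + 1) ∧
    ((G.maxDegree = 2 ∨ G.maxDegree = 3 ∨ G.maxDegree = 4) →
      correspondencePackingNumber G ≤ ((2 * ⌈((G.maxDegree : ℚ) + 1) / 2⌉₊ : ℕ) : ℕ∞)) ∧
    (G.maxDegree ≤ 3 →
      listPackingNumber G ≤ correspondencePackingNumber G ∧
        correspondencePackingNumber G ≤ 4) := by
  have hlist := listPackingNumber_le_correspondencePackingNumber G
  have hfour : G.maxDegree ≤ 3 → correspondencePackingNumber G ≤ 4 := fun h =>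
    correspondencePackingNumber_le_four (degreeLE_of_maxDegree_le h)
  refine ⟨?_, ?_, fun h => ⟨hlist, hfour h⟩⟩
  · rintro (h | h)
    · rw [h]
      exact (listPackingNumber_le_three (degreeLE_of_maxDegree_le h.le)).trans_eq (by norm_num)
    · rw [h]
      exact (hlist.trans (hfour h.le)).trans_eq (by norm_num)
  · have ceil_eq : ∀ (x : ℚ) (n : ℕ), (n : ℚ) < x → x ≤ n + 1 → ⌈x⌉₊ = n + 1 := by
      intro x n h1 h2
      exact (Nat.ceil_eq_iff (Nat.succ_ne_zero n)).2 ⟨by simpa using h1, by push_cast; exact h2⟩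
    rintro (h | h | h)
    · rw [h, ceil_eq _ 1 (by norm_num) (by norm_num)]
      exact (hfour (by omega)).trans_eq (by norm_num)
    · rw [h, ceil_eq _ 1 (by norm_num) (by norm_num)]
      exact (hfour (by omega)).trans_eq (by norm_num)
    · rw [h, ceil_eq _ 2 (by norm_num) (by norm_num)]
      exact (correspondencePackingNumber_le_six (degreeLE_of_maxDegree_le h.le)).trans_eq
        (by norm_num)
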